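/- Let $n\ge 1$ and let $\Omega\subset\mathbb{C}^n$ be a domain (a non-empty connected open set). Identify $\mathbb{C}^n$ with $\mathbb{R}^{2n}$, with real coordinates $x_1,\dots,x_{2n}$ (the real and imaginary parts of the complex coordinates). Let $E\subset\Omega$ be closed in $\Omega$ with $\mathcal{H}^{2n-1}(E)=0$, where $\mathcal{H}^{2n-1}$ is the $(2n-1)$-dimensional Hausdorff measure. Let $f:\Omega\setminus E\to\mathbb{C}$ be holomorphic and such that (i) $f\in L^1_{\mathrm{loc}}(\Omega)$, (ii) for each $j$, $1\le j\le 2n$, $\dfrac{\partial^2 f}{\partial x_j^2}\in L^1_{\mathrm{loc}}(\Omega)$. Here $f$ and the pointwise derivatives $\partial^2 f/\partial x_j^2$ are functions on $\Omega\setminus E$, and such a function $g$ is in $L^1_{\mathrm{loc}}(\Omega)$ if every point of $\Omega$ (including the points of $E$) has a neighbourhood $U\subset\Omega$ such that $g$ is Lebesgue integrable over $U\setminus E$. Then $f$ has a unique holomorphic extension to $\Omega$, that is, there is exactly one holomorphic function $g:\Omega\to\mathbb{C}$ with $g=f$ on $\Omega\setminus E$. -/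

import Mathlib

open MeasureTheory Set

/-- The `2n` real coordinate directions of `ℂⁿ ≅ ℝ²ⁿ`: with `z_k = x_k + i y_k`, `Sum.inl k` is the
direction of `x_k` and `Sum.inr k` is the direction of `y_k`. -/
noncomputable def realDirection (n : ℕ) : Fin n ⊕ Fin n → EuclideanSpace ℂ (Fin n)
  | Sum.inl k => EuclideanSpace.single k 1
  | Sum.inr k => EuclideanSpace.single k Complex.I

/-- The pure second partial derivative `∂²f/∂x_j²` with respect to the `j`-th real coordinate
of `ℂⁿ ≅ ℝ²ⁿ`. -/
noncomputable def purePartial2 {n : ℕ} (j : Fin n ⊕ Fin n) (f : EuclideanSpace ℂ (Fin n) → ℂ) :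
    EuclideanSpace ℂ (Fin n) → ℂ :=
  fun z => lineDeriv ℝ (fun w => lineDeriv ℝ f w (realDirection n j)) z (realDirection n j)

/-- A function `g` that is given on `Ω \ E` is in `L¹_loc(Ω)`: every point of `Ω` (also the points
of `E`) has a neighbourhood in `Ω` on which `g` is Lebesgue integrable. The values that the total
function `g` takes on `E` play no role, as the measure is restricted to the complement of `E`. -/
def MemL1Loc {n : ℕ} (Ω E : Set (EuclideanSpace ℂ (Fin n)))
    (g : EuclideanSpace ℂ (Fin n) → ℂ) : Prop :=
  LocallyIntegrableOn g Ω (volume.restrict Eᶜ)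

/-- `g` is a holomorphic function on `Ω` that agrees with `f` on `Ω \ E`. -/
def IsHolomorphicExtension {n : ℕ} (Ω E : Set (EuclideanSpace ℂ (Fin n)))
    (f g : EuclideanSpace ℂ (Fin n) → ℂ) : Prop :=
  DifferentiableOn ℂ g Ω ∧ EqOn g f (Ω \ E)

/-!
Almost every line in a coordinate direction misses `E`, and along such a line one can integrate by
parts twice. By Fubini the second derivatives `∂²f/∂x_j²` are therefore distributional derivatives
across `E`. Their sum vanishes since `f` is holomorphic, so `f` is weakly harmonic on `Ω`. Weyl's
lemma, proved here by differentiating in `r` the means of `f` with respect to the weights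
`(r² - ‖y - a‖²)₊²`, shows that `f` agrees off `E` with a function that is locally `C¹`. Where the
real derivative of a `C¹` function is complex linear is a closed condition, so that function is
holomorphic across `E`.
-/

open Filter Topology InnerProductSpace Laplacian Module Convolution

section Slicing

variable {G : Type*} [NormedAddCommGroup G] [NormedSpace ℝ G] {m : ℕ}

theorem exists_continuousLinearEquiv_pi_prod_real_apply_eq [FiniteDimensional ℝ G]
    (hm : finrank ℝ G = m + 1) {v : G} (hv : v ≠ 0) :
    ∃ L : G ≃L[ℝ] (Fin m → ℝ) × ℝ, L v = (0, 1) := by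
  let L₀ : G ≃L[ℝ] (Fin m → ℝ) × ℝ := ContinuousLinearEquiv.ofFinrankEq (by simp [hm])
  obtain ⟨M, hM⟩ : ∃ M : ((Fin m → ℝ) × ℝ) ≃L[ℝ] (Fin m → ℝ) × ℝ, M (L₀ v) = (0, 1) :=
    SeparatingDual.exists_continuousLinearEquiv_apply_eq (by simpa using hv) (by simp)
  exact ⟨L₀.trans M, hM⟩

theorem symm_apply_eq_add_smul {L : G ≃L[ℝ] (Fin m → ℝ) × ℝ} {v : G} (hL : L v = (0, 1))
    (y : Fin m → ℝ) (t : ℝ) : L.symm (y, t) = L.symm (y, 0) + t • v := by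
  apply L.injective
  simp [hL]

variable [MeasurableSpace G] [BorelSpace G] {E : Set G}

theorem ae_forall_symm_apply_notMem (L : G ≃L[ℝ] (Fin m → ℝ) × ℝ)
    (hE : Measure.hausdorffMeasure (m : ℝ) E = 0) :
    ∀ᵐ y : Fin m → ℝ, ∀ t : ℝ, L.symm (y, t) ∉ E := by
  let T : G →L[ℝ] Fin m → ℝ := (ContinuousLinearMap.fst ℝ _ ℝ).comp (L : G →L[ℝ] _)
  have hTE : volume (T '' E) = 0 := by
    have hle := T.lipschitz.hausdorffMeasure_image_le (d := (m : ℝ)) m.cast_nonneg E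
    have hvol : (Measure.hausdorffMeasure (m : ℝ) : Measure (Fin m → ℝ)) = volume := by
      simpa using hausdorffMeasure_pi_real (ι := Fin m)
    rw [hE, mul_zero, hvol] at hle
    exact le_antisymm hle bot_le
  filter_upwards [measure_eq_zero_iff_ae_notMem.1 hTE] with y hy t ht
  exact hy ⟨_, ht, by simp [T]⟩

variable (μ : Measure G) [μ.IsAddHaarMeasure]

theorem exists_map_eq_smul_volume_prod (L : G ≃L[ℝ] (Fin m → ℝ) × ℝ) :
    ∃ c : NNReal, c ≠ 0 ∧ μ.map L = c • (volume : Measure (Fin m → ℝ)).prod volume := by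
  have : (μ.map L).IsAddHaarMeasure := L.isAddHaarMeasure_map μ
  exact ⟨_, (Measure.addHaarScalarFactor_pos_of_isAddHaarMeasure _ _).ne',
    Measure.isAddLeftInvariant_eq_smul _ _⟩

variable [FiniteDimensional ℝ G] {F : Type*} [NormedAddCommGroup F] [NormedSpace ℝ F]

theorem measure_eq_zero_of_hausdorffMeasure_eq_zero {d : ℝ} (hd : d ≤ finrank ℝ G)
    (hE : Measure.hausdorffMeasure d E = 0) : μ E = 0 :=
  Measure.absolutelyContinuous_isAddHaarMeasure μ (Measure.hausdorffMeasure (finrank ℝ G : ℝ))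
    (le_antisymm ((Measure.hausdorffMeasure_mono hd E).trans hE.le) bot_le)

theorem integral_eq_zero_of_forall_line_notMem
    (hE : Measure.hausdorffMeasure (finrank ℝ G - 1 : ℝ) E = 0) {v : G} (hv : v ≠ 0) {f : G → F}
    (hf : Integrable f μ)
    (hline : ∀ x, (∀ t : ℝ, x + t • v ∉ E) → Integrable (fun t : ℝ => f (x + t • v)) →
      ∫ t : ℝ, f (x + t • v) = 0) :
    ∫ x, f x ∂μ = 0 := by
  obtain ⟨m, hm⟩ : ∃ m, finrank ℝ G = m + 1 :=
    Nat.exists_eq_add_one.2 (finrank_pos_iff_exists_ne_zero.2 ⟨v, hv⟩)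
  have hEm : Measure.hausdorffMeasure (m : ℝ) E = 0 := by simpa [hm] using hE
  obtain ⟨L, hL⟩ := exists_continuousLinearEquiv_pi_prod_real_apply_eq hm hv
  obtain ⟨c, hc, hmap⟩ := exists_map_eq_smul_volume_prod μ L
  have hLemb : MeasurableEmbedding L := L.toHomeomorph.measurableEmbedding
  have hf_map : Integrable (fun p => f (L.symm p)) (μ.map L) := by
    rw [hLemb.integrable_map_iff]
    simpa [Function.comp_def] using hf
  have hf_prod : Integrable (fun p => f (L.symm p))
      ((volume : Measure (Fin m → ℝ)).prod volume) := by
    rw [hmap] at hf_map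
    exact (integrable_smul_measure (c := (c : ENNReal)) (by simpa using hc) (by simp)).1 hf_map
  have hfubini : ∫ p, f (L.symm p) ∂((volume : Measure (Fin m → ℝ)).prod volume) = 0 := by
    rw [integral_prod _ hf_prod]
    refine integral_eq_zero_of_ae ?_
    filter_upwards [ae_forall_symm_apply_notMem L hEm, hf_prod.prod_right_ae] with y hyE hy
    have hy_line := symm_apply_eq_add_smul hL y
    generalize L.symm (y, 0) = x at hy_line
    simp only [hy_line] at hyE hy ⊢
    exact hline x hyE hy
  calc ∫ x, f x ∂μ = ∫ p, f (L.symm p) ∂(μ.map L) := by rw [hLemb.integral_map]; simp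
    _ = 0 := by rw [hmap, integral_smul_nnreal_measure, hfubini, smul_zero]

end Slicing

section LineDeriv

variable {𝕜 G F : Type*} [NontriviallyNormedField 𝕜] [NormedAddCommGroup G] [NormedSpace 𝕜 G]
  [NormedAddCommGroup F] [NormedSpace 𝕜 F]

theorem deriv_comp_add_smul (f : G → F) (x v : G) :
    deriv (fun t : 𝕜 => f (x + t • v)) = fun t => lineDeriv 𝕜 f (x + t • v) v := by
  ext t
  simp only [lineDeriv, add_assoc, ← add_smul]
  rw [deriv_comp_const_add (fun s : 𝕜 => f (x + s • v)), add_zero]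

theorem differentiableAt_comp_add_smul_iff {f : G → F} {x v : G} {t : 𝕜} :
    DifferentiableAt 𝕜 (fun s : 𝕜 => f (x + s • v)) t ↔ LineDifferentiableAt 𝕜 f (x + t • v) v := by
  rw [differentiableAt_iff_comp_const_add (a := t) (b := t), neg_add_cancel]
  simp only [LineDifferentiableAt, add_smul, add_assoc]

end LineDeriv

section IntegrationByParts

variable {F : Type*} [NormedAddCommGroup F] [NormedSpace ℝ F]

theorem integral_deriv_deriv_smul_sub_smul_deriv_deriv {p : ℝ → ℝ} {u : ℝ → F}
    (hp : ContDiff ℝ 2 p) (hpc : HasCompactSupport p)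
    (hu : ∀ t ∈ tsupport p, DifferentiableAt ℝ u t)
    (hu' : ∀ t ∈ tsupport p, DifferentiableAt ℝ (deriv u) t)
    (hint : Integrable fun t => deriv (deriv p) t • u t - p t • deriv (deriv u) t) :
    ∫ t, (deriv (deriv p) t • u t - p t • deriv (deriv u) t) = 0 := by
  set W : ℝ → F := fun t => deriv p t • u t - p t • deriv u t with hW
  have hp' : ContDiff ℝ 1 (deriv p) := (contDiff_succ_iff_deriv.1 hp).2.2
  have hWderiv (t : ℝ) :
      HasDerivAt W (deriv (deriv p) t • u t - p t • deriv (deriv u) t) t := by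
    by_cases ht : t ∈ tsupport p
    · convert! ((hp'.differentiable one_ne_zero t).hasDerivAt.smul (hu t ht).hasDerivAt).sub
        ((hp.differentiable two_ne_zero t).hasDerivAt.smul (hu' t ht).hasDerivAt) using 1
      abel
    · have hp0 : p =ᶠ[𝓝 t] 0 := notMem_tsupport_iff_eventuallyEq.1 ht
      have hp'0 : deriv p =ᶠ[𝓝 t] 0 := hp0.deriv.trans (by simp)
      have hp''0 : deriv (deriv p) t = 0 := by simp [hp'0.deriv_eq]
      have hW0 : W =ᶠ[𝓝 t] fun _ => 0 := by
        filter_upwards [hp0, hp'0] with s hs hs'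
        simp [hW, hs, hs']
      simpa [hp''0, hp0.eq_of_nhds] using (hasDerivAt_const t (0 : F)).congr_of_eventuallyEq hW0
  have hWc : HasCompactSupport W := hpc.deriv.smul_right.sub hpc.smul_right
  have hWcont : Continuous W := continuous_iff_continuousAt.2 fun t => (hWderiv t).continuousAt
  exact integral_eq_zero_of_hasDerivAt_of_integrable hWderiv hint
    (hWcont.integrable_of_hasCompactSupport hWc)

variable {G : Type*} [NormedAddCommGroup G] [NormedSpace ℝ G]

theorem contDiff_lineDeriv {φ : G → F} {k l : WithTop ℕ∞} (hφ : ContDiff ℝ l φ) (hkl : k + 1 ≤ l)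
    (v : G) : ContDiff ℝ k fun y => lineDeriv ℝ φ y v := by
  have hφ' : Differentiable ℝ φ := hφ.differentiable (by rintro rfl; simp at hkl)
  rw [funext fun y => (hφ' y).lineDeriv_eq_fderiv]
  exact (hφ.fderiv_right hkl).clm_apply contDiff_const

theorem tsupport_lineDeriv_subset (φ : G → F) (v : G) :
    (tsupport fun y => lineDeriv ℝ φ y v) ⊆ tsupport φ := by
  refine closure_minimal (fun y hy => ?_) (isClosed_tsupport φ)
  by_contra hyφ
  have hφ0 : φ =ᶠ[𝓝 y] fun _ => 0 := notMem_tsupport_iff_eventuallyEq.1 hyφ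
  exact hy (hφ0.lineDeriv_eq.trans (by simp [lineDeriv]))

theorem integrable_smul_of_integrableOn_tsupport {X : Type*} [TopologicalSpace X] [T2Space X]
    [MeasurableSpace X] [OpensMeasurableSpace X] {μ : Measure X} {φ : X → ℝ} (hφ : Continuous φ)
    (hφc : HasCompactSupport φ) {f : X → F} (hf : IntegrableOn f (tsupport φ) μ) :
    Integrable (fun x => φ x • f x) μ := by
  refine (integrableOn_iff_integrable_of_support_subset fun y hy => ?_).1
    (hf.continuousOn_smul hφ.continuousOn hφc)
  exact subset_tsupport φ (left_ne_zero_of_smul hy)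

variable [MeasurableSpace G] [BorelSpace G] {μ : Measure G}

theorem integrable_lineDeriv_lineDeriv_smul {φ : G → ℝ} (hφ : ContDiff ℝ 2 φ)
    (hφc : HasCompactSupport φ) {f : G → F} (hf : IntegrableOn f (tsupport φ) μ) (v : G) :
    Integrable (fun x => lineDeriv ℝ (fun y => lineDeriv ℝ φ y v) x v • f x) μ := by
  have hsupp : (tsupport fun x => lineDeriv ℝ (fun y => lineDeriv ℝ φ y v) x v) ⊆ tsupport φ :=
    (tsupport_lineDeriv_subset _ v).trans (tsupport_lineDeriv_subset φ v)
  have hφ'' : Continuous fun x => lineDeriv ℝ (fun y => lineDeriv ℝ φ y v) x v :=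
    (contDiff_lineDeriv (contDiff_lineDeriv hφ one_add_one_eq_two.le v)
      (zero_add 1).le v).continuous
  exact integrable_smul_of_integrableOn_tsupport hφ''
    (hφc.mono' ((subset_tsupport _).trans hsupp)) (hf.mono_set hsupp)

variable [FiniteDimensional ℝ G] (μ) [μ.IsAddHaarMeasure]

theorem integral_lineDeriv_lineDeriv_smul_eq {E : Set G}
    (hE : Measure.hausdorffMeasure (finrank ℝ G - 1 : ℝ) E = 0) {v : G} (hv : v ≠ 0) {φ : G → ℝ}
    (hφ : ContDiff ℝ 2 φ) (hφc : HasCompactSupport φ) {f : G → F}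
    (hf : ∀ x ∈ tsupport φ \ E, LineDifferentiableAt ℝ f x v)
    (hf' : ∀ x ∈ tsupport φ \ E, LineDifferentiableAt ℝ (fun y => lineDeriv ℝ f y v) x v)
    (hint : IntegrableOn f (tsupport φ) μ)
    (hint' : IntegrableOn (fun x => lineDeriv ℝ (fun y => lineDeriv ℝ f y v) x v) (tsupport φ) μ) :
    ∫ x, lineDeriv ℝ (fun y => lineDeriv ℝ φ y v) x v • f x ∂μ =
      ∫ x, φ x • lineDeriv ℝ (fun y => lineDeriv ℝ f y v) x v ∂μ := by
  have hint_left := integrable_lineDeriv_lineDeriv_smul hφ hφc hint v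
  have hint_right := integrable_smul_of_integrableOn_tsupport hφ.continuous hφc hint'
  rw [← sub_eq_zero, ← integral_sub hint_left hint_right]
  refine integral_eq_zero_of_forall_line_notMem μ hE hv (hint_left.sub hint_right)
    fun x hxE hx_int => ?_
  have hline : Topology.IsClosedEmbedding fun t : ℝ => x + t • v :=
    (Homeomorph.addLeft x).isClosedEmbedding.comp (isClosedEmbedding_smul_left hv)
  have hmem {t : ℝ} (ht : t ∈ tsupport fun s : ℝ => φ (x + s • v)) :
      x + t • v ∈ tsupport φ \ E :=
    ⟨tsupport_comp_subset_preimage φ hline.continuous ht, hxE t⟩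
  have hgreen := integral_deriv_deriv_smul_sub_smul_deriv_deriv
    (p := fun t : ℝ => φ (x + t • v)) (u := fun t => f (x + t • v))
    (hφ.comp (by fun_prop)) (hφc.comp_isClosedEmbedding hline)
    (fun t ht => differentiableAt_comp_add_smul_iff.2 (hf _ (hmem ht)))
  simp only [deriv_comp_add_smul, deriv_comp_add_smul fun y => lineDeriv ℝ φ y v,
    deriv_comp_add_smul fun y => lineDeriv ℝ f y v] at hgreen
  exact hgreen (fun t ht => differentiableAt_comp_add_smul_iff.2 (hf' _ (hmem ht))) hx_int

end IntegrationByParts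

section WeaklyHarmonic

variable {G : Type*} [NormedAddCommGroup G] [InnerProductSpace ℝ G] [FiniteDimensional ℝ G]

theorem laplacian_eq_sum_lineDeriv_lineDeriv {ι : Type*} [Fintype ι] (b : OrthonormalBasis ι ℝ G)
    {φ : G → ℝ} (hφ : ContDiff ℝ 2 φ) (x : G) :
    Δ φ x = ∑ i, lineDeriv ℝ (fun y => lineDeriv ℝ φ y (b i)) x (b i) := by
  have hφ' : Differentiable ℝ φ := hφ.differentiable two_ne_zero
  have hφ'' : DifferentiableAt ℝ (fderiv ℝ φ) x :=
    (hφ.fderiv_right one_add_one_eq_two.le).differentiable one_ne_zero x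
  rw [laplacian_eq_iteratedFDeriv_orthonormalBasis φ b]
  refine Finset.sum_congr rfl fun i _ => ?_
  rw [iteratedFDeriv_two_apply, funext fun y => (hφ' y).lineDeriv_eq_fderiv,
    (hφ''.clm_apply (differentiableAt_const (b i))).lineDeriv_eq_fderiv]
  simp [fderiv_clm_apply hφ'' (differentiableAt_const (b i))]

theorem tsupport_laplacian_subset (φ : G → ℝ) : tsupport (Δ φ) ⊆ tsupport φ := by
  refine closure_minimal (fun y hy => ?_) (isClosed_tsupport φ)
  by_contra hyφ
  have hφ0 : φ =ᶠ[𝓝 y] fun _ => 0 := notMem_tsupport_iff_eventuallyEq.1 hyφ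
  exact hy ((laplacian_congr_nhds hφ0).eq_of_nhds.trans (by simp [laplacian_const]))

variable [MeasurableSpace G] {F : Type*} [NormedAddCommGroup F] [NormedSpace ℝ F]

/-- Weak harmonicity on an open set `Ω`: `f` annihilates the Laplacians of compactly supported test
functions. The test functions are only required to be `C²`. -/
def IsWeaklyHarmonicOn (μ : Measure G) (f : G → F) (Ω : Set G) : Prop :=
  ∀ φ : G → ℝ, ContDiff ℝ 2 φ → HasCompactSupport φ → tsupport φ ⊆ Ω → ∫ x, Δ φ x • f x ∂μ = 0

variable {μ : Measure G} {f : G → F} {Ω : Set G}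

namespace IsWeaklyHarmonicOn

theorem mono {U : Set G} (hf : IsWeaklyHarmonicOn μ f Ω) (hU : U ⊆ Ω) : IsWeaklyHarmonicOn μ f U :=
  fun φ hφ hφc hφU => hf φ hφ hφc (hφU.trans hU)

theorem congr {g : G → F} (hf : IsWeaklyHarmonicOn μ f Ω) (hfg : EqOn f g Ω) :
    IsWeaklyHarmonicOn μ g Ω := by
  intro φ hφ hφc hφΩ
  rw [← hf φ hφ hφc hφΩ]
  congr 1 with x
  by_cases hx : x ∈ tsupport (Δ φ)
  · rw [hfg (hφΩ (tsupport_laplacian_subset φ hx))]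
  · rw [image_eq_zero_of_notMem_tsupport hx, zero_smul, zero_smul]

end IsWeaklyHarmonicOn

variable [BorelSpace G] [μ.IsAddHaarMeasure] {ι : Type*} [Fintype ι]

theorem isWeaklyHarmonicOn_of_hausdorffMeasure_eq_zero (b : OrthonormalBasis ι ℝ G) {E : Set G}
    (hE : Measure.hausdorffMeasure (finrank ℝ G - 1 : ℝ) E = 0)
    (hf : ∀ i, ∀ x ∈ Ω \ E, LineDifferentiableAt ℝ f x (b i))
    (hf' : ∀ i, ∀ x ∈ Ω \ E, LineDifferentiableAt ℝ (fun y => lineDeriv ℝ f y (b i)) x (b i))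
    (hsum : ∀ x ∈ Ω \ E, ∑ i, lineDeriv ℝ (fun y => lineDeriv ℝ f y (b i)) x (b i) = 0)
    (hint : LocallyIntegrableOn f Ω μ)
    (hint' : ∀ i,
      LocallyIntegrableOn (fun x => lineDeriv ℝ (fun y => lineDeriv ℝ f y (b i)) x (b i)) Ω μ) :
    IsWeaklyHarmonicOn μ f Ω := by
  intro φ hφ hφc hφΩ
  have hE_ae : ∀ᵐ x ∂μ, x ∉ E :=
    measure_eq_zero_iff_ae_notMem.1 (measure_eq_zero_of_hausdorffMeasure_eq_zero μ (by simp) hE)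
  have hint_tsupport := hint.integrableOn_compact_subset hφΩ hφc
  have hint_tsupport' (i) := (hint' i).integrableOn_compact_subset hφΩ hφc
  have hsub : tsupport φ \ E ⊆ Ω \ E := sdiff_subset_sdiff_left hφΩ
  have hint_left (i) := integrable_lineDeriv_lineDeriv_smul hφ hφc hint_tsupport (b i)
  have hint_right (i) := integrable_smul_of_integrableOn_tsupport hφ.continuous hφc
    (hint_tsupport' i)
  calc ∫ x, Δ φ x • f x ∂μ
      = ∫ x, ∑ i, lineDeriv ℝ (fun y => lineDeriv ℝ φ y (b i)) x (b i) • f x ∂μ := by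
        simp only [laplacian_eq_sum_lineDeriv_lineDeriv b hφ, Finset.sum_smul]
    _ = ∫ x, ∑ i, φ x • lineDeriv ℝ (fun y => lineDeriv ℝ f y (b i)) x (b i) ∂μ := by
        rw [integral_finsetSum _ fun i _ => hint_left i,
          integral_finsetSum _ fun i _ => hint_right i]
        exact Finset.sum_congr rfl fun i _ => integral_lineDeriv_lineDeriv_smul_eq μ hE
          (b.orthonormal.ne_zero i) hφ hφc (fun x hx => hf i x (hsub hx))
          (fun x hx => hf' i x (hsub hx)) hint_tsupport (hint_tsupport' i)
    _ = 0 := by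
        refine integral_eq_zero_of_ae ?_
        filter_upwards [hE_ae] with x hxE
        by_cases hx : x ∈ tsupport φ
        · rw [← Finset.smul_sum, hsum x ⟨hφΩ hx, hxE⟩, smul_zero, Pi.zero_apply]
        · simp [image_eq_zero_of_notMem_tsupport hx]

end WeaklyHarmonic

section PositivePart

theorem hasDerivAt_max_zero_pow (k : ℕ) (u : ℝ) :
    HasDerivAt (fun u : ℝ => max 0 u ^ (k + 2)) ((k + 2) * max 0 u ^ (k + 1)) u := by
  rcases lt_trichotomy u 0 with hu | rfl | hu
  · have hloc : (fun u : ℝ => max 0 u ^ (k + 2)) =ᶠ[𝓝 u] fun _ => 0 := by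
      filter_upwards [Iio_mem_nhds hu] with y hy
      simp [max_eq_left (mem_Iio.1 hy).le]
    simpa [max_eq_left hu.le] using (hasDerivAt_const u (0 : ℝ)).congr_of_eventuallyEq hloc
  · have hbound : (fun u : ℝ => max 0 u ^ (k + 2)) =O[𝓝 0] fun u : ℝ => u ^ (k + 2) := by
      refine Asymptotics.IsBigO.of_bound' (Eventually.of_forall fun y => ?_)
      rw [norm_pow, norm_pow, Real.norm_of_nonneg (le_max_left _ _)]
      exact pow_le_pow_left₀ (le_max_left _ _) (max_le (norm_nonneg _) (le_abs_self _)) _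
    rw [hasDerivAt_iff_isLittleO]
    simpa using hbound.trans_isLittleO
      (Asymptotics.isLittleO_pow_pow (𝕜 := ℝ) (show 1 < k + 2 by lia))
  · have hloc : (fun u : ℝ => max 0 u ^ (k + 2)) =ᶠ[𝓝 u] fun u => u ^ (k + 2) := by
      filter_upwards [Ioi_mem_nhds hu] with y hy
      rw [max_eq_right (mem_Ioi.1 hy).le]
    simpa [max_eq_right hu.le] using (hasDerivAt_pow (k + 2) u).congr_of_eventuallyEq hloc

theorem contDiff_max_zero_pow (k : ℕ) : ContDiff ℝ k fun u : ℝ => max 0 u ^ (k + 1) := by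
  induction k with
  | zero => exact contDiff_zero.2 (by fun_prop)
  | succ k ih =>
    have hderiv : deriv (fun u : ℝ => max 0 u ^ (k + 2)) = fun u =>
        (k + 2 : ℝ) * max 0 u ^ (k + 1) := funext fun u => (hasDerivAt_max_zero_pow k u).deriv
    push_cast
    refine contDiff_succ_iff_deriv.2 ⟨fun u => (hasDerivAt_max_zero_pow k u).differentiableAt,
      by simp, ?_⟩
    rw [hderiv]
    exact contDiff_const.mul ih

end PositivePart

/-- The function `y ↦ (r² - ‖y - a‖²)₊`, a radial bump supported on the closed ball of radius `|r|`
around `a`, whose `(k + 1)`-st power is of class `C^k`. -/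
noncomputable def quadBump {G : Type*} [NormedAddCommGroup G] (a : G) (r : ℝ) (y : G) : ℝ :=
  max 0 (r ^ 2 - ‖y - a‖ ^ 2)

section QuadBump

variable {G : Type*} [NormedAddCommGroup G] {a y : G} {r : ℝ}

theorem quadBump_nonneg : 0 ≤ quadBump a r y := le_max_left _ _

theorem quadBump_le_sq : quadBump a r y ≤ r ^ 2 :=
  max_le (sq_nonneg r) (sub_le_self _ (sq_nonneg _))

theorem quadBump_eq_zero (hy : |r| ≤ ‖y - a‖) : quadBump a r y = 0 :=
  max_eq_left (sub_nonpos.2 (sq_le_sq.2 (by rwa [abs_norm])))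

theorem continuous_quadBump : Continuous (quadBump a r) := by
  unfold quadBump
  fun_prop

theorem norm_sub_sq_mul_quadBump :
    ‖y - a‖ ^ 2 * quadBump a r y = r ^ 2 * quadBump a r y - quadBump a r y ^ 2 := by
  rcases le_total (r ^ 2 - ‖y - a‖ ^ 2) 0 with h | h
  · simp [quadBump, max_eq_left h]
  · simp only [quadBump, max_eq_right h]
    ring

theorem quadBump_zero_sub : quadBump 0 r (a - y) = quadBump a r y := by
  simp [quadBump, norm_sub_rev]

theorem tsupport_quadBump_pow_subset {k : ℕ} (hk : k ≠ 0) :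
    (tsupport fun y => quadBump a r y ^ k) ⊆ Metric.closedBall a |r| := by
  refine closure_minimal (fun y hy => ?_) Metric.isClosed_closedBall
  rw [mem_closedBall_iff_norm]
  by_contra! h
  exact hy (by simp [quadBump_eq_zero h.le, hk])

theorem hasDerivAt_quadBump_sq (a y : G) (r : ℝ) :
    HasDerivAt (fun r => quadBump a r y ^ 2) (4 * r * quadBump a r y) r := by
  have hinner : HasDerivAt (fun r : ℝ => r ^ 2 - ‖y - a‖ ^ 2) (2 * r) r := by
    simpa using (hasDerivAt_pow 2 r).sub_const (‖y - a‖ ^ 2)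
  convert! (hasDerivAt_max_zero_pow 0 (r ^ 2 - ‖y - a‖ ^ 2)).comp r hinner using 1
  simp only [quadBump]
  push_cast
  ring

theorem quadBump_zero_smul [NormedSpace ℝ G] (r : ℝ) (y : G) :
    quadBump 0 r (r • y) = r ^ 2 * quadBump 0 1 y := by
  simp only [quadBump, sub_zero, norm_smul, mul_pow, Real.norm_eq_abs, sq_abs]
  rw [mul_max_of_nonneg _ _ (sq_nonneg r)]
  ring_nf

variable [InnerProductSpace ℝ G]

theorem contDiff_quadBump_pow (a : G) (r : ℝ) (k : ℕ) :
    ContDiff ℝ k fun y => quadBump a r y ^ (k + 1) :=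
  (contDiff_max_zero_pow k).comp
    (contDiff_const.sub ((contDiff_id.sub contDiff_const).norm_sq ℝ))

theorem hasLineDerivAt_quadBump_pow (k : ℕ) (a y v : G) (r : ℝ) :
    HasLineDerivAt ℝ (fun y => quadBump a r y ^ (k + 2))
      (-2 * (k + 2) * inner ℝ (y - a) v * quadBump a r y ^ (k + 1)) y v := by
  have hline : HasDerivAt (fun t : ℝ => y + t • v - a) v 0 := by
    simpa using (((hasDerivAt_id (0 : ℝ)).smul_const v).const_add y).sub_const a
  rw [HasLineDerivAt]
  convert! (hasDerivAt_max_zero_pow k (r ^ 2 - ‖y + (0 : ℝ) • v - a‖ ^ 2)).comp 0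
    (hline.norm_sq.const_sub (r ^ 2)) using 1
  simp only [zero_smul, add_zero, quadBump]
  ring

theorem hasLineDerivAt_inner_mul_quadBump_sq (a y v : G) (r : ℝ) :
    HasLineDerivAt ℝ (fun y => -6 * inner ℝ (y - a) v * quadBump a r y ^ 2)
      (24 * inner ℝ (y - a) v ^ 2 * quadBump a r y - 6 * ‖v‖ ^ 2 * quadBump a r y ^ 2) y v := by
  have hline : HasDerivAt (fun t : ℝ => y + t • v - a) v 0 := by
    simpa using (((hasDerivAt_id (0 : ℝ)).smul_const v).const_add y).sub_const a
  have hinner := (hline.inner ℝ (hasDerivAt_const (0 : ℝ) v)).const_mul (-6)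
  have hsq : HasDerivAt (fun t : ℝ => quadBump a r (y + t • v) ^ 2) _ 0 :=
    hasLineDerivAt_quadBump_pow 0 a y v r
  rw [HasLineDerivAt]
  convert! hinner.mul hsq using 1
  simp only [zero_smul, add_zero, inner_zero_right, real_inner_self_eq_norm_sq]
  push_cast
  ring

variable [FiniteDimensional ℝ G]

theorem hasCompactSupport_quadBump_pow (a : G) (r : ℝ) {k : ℕ} (hk : k ≠ 0) :
    HasCompactSupport fun y => quadBump a r y ^ k :=
  (isCompact_closedBall a |r|).of_isClosed_subset (isClosed_tsupport _)
    (tsupport_quadBump_pow_subset hk)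

theorem laplacian_quadBump_cube (a y : G) (r : ℝ) :
    Δ (fun y => quadBump a r y ^ 3) y =
      6 * (4 * r ^ 2 * quadBump a r y - (finrank ℝ G + 4) * quadBump a r y ^ 2) := by
  have hderiv (v : G) : (fun y => lineDeriv ℝ (fun y => quadBump a r y ^ 3) y v) =
      fun y => -6 * inner ℝ (y - a) v * quadBump a r y ^ 2 := by
    ext y
    rw [(hasLineDerivAt_quadBump_pow 1 a y v r).lineDeriv]
    norm_num
  let b := stdOrthonormalBasis ℝ G
  calc Δ (fun y => quadBump a r y ^ 3) y
      = ∑ i, (24 * inner ℝ (y - a) (b i) ^ 2 * quadBump a r y - 6 * quadBump a r y ^ 2) := by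
        rw [laplacian_eq_sum_lineDeriv_lineDeriv b (contDiff_quadBump_pow a r 2)]
        simp only [hderiv, (hasLineDerivAt_inner_mul_quadBump_sq a y _ r).lineDeriv,
          b.norm_eq_one, one_pow, mul_one]
    _ = 24 * (‖y - a‖ ^ 2 * quadBump a r y) - finrank ℝ G * (6 * quadBump a r y ^ 2) := by
        rw [Finset.sum_sub_distrib, ← Finset.sum_mul, ← Finset.mul_sum, b.sum_sq_inner_left]
        simp [mul_assoc]
    _ = _ := by
        rw [norm_sub_sq_mul_quadBump]
        ring

variable [MeasurableSpace G] [BorelSpace G] {μ : Measure G} {F : Type*} [NormedAddCommGroup F]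
  [NormedSpace ℝ F] {f : G → F}

theorem integrable_quadBump_pow_smul (hf : LocallyIntegrable f μ) (a : G) (r : ℝ) {k : ℕ}
    (hk : k ≠ 0) : Integrable (fun y => quadBump a r y ^ k • f y) μ :=
  hf.integrable_smul_left_of_hasCompactSupport (continuous_quadBump.pow k)
    (hasCompactSupport_quadBump_pow a r hk)

theorem hasDerivAt_integral_quadBump_sq_smul (hf : LocallyIntegrable f μ) (a : G) (r : ℝ) :
    HasDerivAt (fun r => ∫ y, quadBump a r y ^ 2 • f y ∂μ)
      ((4 * r) • ∫ y, quadBump a r y • f y ∂μ) r := by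
  set R : ℝ := |r| + 1
  have hint (s : ℝ) : Integrable (fun y => (4 * s * quadBump a s y) • f y) μ := by
    simp only [mul_smul (4 * s)]
    simpa using (integrable_quadBump_pow_smul hf a s one_ne_zero).fun_smul (4 * s)
  have hbound (y : G) (s : ℝ) (hs : |s| < R) : ‖(4 * s * quadBump a s y) • f y‖ ≤
      (Metric.closedBall a R).indicator (fun y => 4 * R * R ^ 2 * ‖f y‖) y := by
    rcases le_or_gt ‖y - a‖ R with hy | hy
    · have hle : quadBump a s y ≤ R ^ 2 :=
        quadBump_le_sq.trans (sq_le_sq.2 (hs.le.trans (le_abs_self R)))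
      rw [indicator_of_mem (mem_closedBall_iff_norm.2 hy), norm_smul, norm_mul, norm_mul,
        Real.norm_of_nonneg quadBump_nonneg, Real.norm_ofNat, Real.norm_eq_abs]
      have hnonneg := quadBump_nonneg (a := a) (r := s) (y := y)
      gcongr
    · rw [indicator_of_notMem fun h => hy.not_ge (mem_closedBall_iff_norm.1 h)]
      simp [quadBump_eq_zero (hs.trans hy).le]
  have hderiv := (hasDerivAt_integral_of_dominated_loc_of_deriv_le (μ := μ)
    (F := fun s y => quadBump a s y ^ 2 • f y) (F' := fun s y => (4 * s * quadBump a s y) • f y)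
    (Metric.ball_mem_nhds r one_pos)
    (Eventually.of_forall fun s =>
      (integrable_quadBump_pow_smul hf a s two_ne_zero).aestronglyMeasurable)
    (integrable_quadBump_pow_smul hf a r two_ne_zero) (hint r).aestronglyMeasurable
    (Eventually.of_forall fun y s hs => hbound y s ?_)
    ((integrable_indicator_iff measurableSet_closedBall).2
      ((hf.integrableOn_isCompact (isCompact_closedBall a R)).norm.const_mul _))
    (Eventually.of_forall fun y s _ => (hasDerivAt_quadBump_sq a y s).smul_const (f y))).2
  · simpa only [mul_smul _ (quadBump a r _), integral_smul] using hderiv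
  · rw [Metric.mem_ball, Real.dist_eq] at hs
    linarith [abs_sub_abs_le_abs_sub s r]

end QuadBump

theorem pow_smul_eq_pow_smul_of_forall_hasDerivAt {F : Type*} [NormedAddCommGroup F]
    [NormedSpace ℝ F] {M M' : ℝ → F} {R : ℝ} {m : ℕ} (hM : ∀ r ∈ Ioo 0 R, HasDerivAt M (M' r) r)
    (hM' : ∀ r ∈ Ioo 0 R, r • M' r = (m : ℝ) • M r) {r s : ℝ} (hr : r ∈ Ioo 0 R)
    (hs : s ∈ Ioo 0 R) : s ^ m • M r = r ^ m • M s := by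
  have hquot (t) (ht : t ∈ Ioo 0 R) : HasDerivAt (fun t => (t ^ m)⁻¹ • M t) 0 t := by
    have ht0 : t ≠ 0 := ht.1.ne'
    have hEuler : M' t = (t⁻¹ * m) • M t := by
      rw [mul_smul, ← hM' t ht, inv_smul_smul₀ ht0]
    convert! ((hasDerivAt_pow m t).fun_inv (pow_ne_zero m ht0)).fun_smul (hM t ht) using 1
    rw [hEuler, smul_smul, ← add_smul]
    refine (smul_eq_zero_of_left ?_ _).symm
    rcases m with _ | m
    · simp
    · simp only [Nat.add_sub_cancel]
      field_simp
      ring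
  have hconst := isOpen_Ioo.is_const_of_deriv_eq_zero isPreconnected_Ioo
    (fun t ht => (hquot t ht).differentiableAt.differentiableWithinAt)
    (fun t ht => (hquot t ht).deriv) hr hs
  rw [inv_smul_eq_iff₀ (pow_ne_zero m hr.1.ne')] at hconst
  rw [hconst, smul_comm, smul_inv_smul₀ (pow_ne_zero m hs.1.ne')]

section Weyl

variable {G : Type*} [NormedAddCommGroup G] [InnerProductSpace ℝ G] [FiniteDimensional ℝ G]
  [MeasurableSpace G] [BorelSpace G] {μ : Measure G}
  {F : Type*} [NormedAddCommGroup F] [NormedSpace ℝ F] {f : G → F} {a : G} {r s R : ℝ}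

theorem IsWeaklyHarmonicOn.smul_integral_quadBump_smul_eq
    (hharm : IsWeaklyHarmonicOn μ f (Metric.closedBall a |r|)) (hf : LocallyIntegrable f μ) :
    (4 * r ^ 2) • ∫ y, quadBump a r y • f y ∂μ =
      ((finrank ℝ G + 4 : ℕ) : ℝ) • ∫ y, quadBump a r y ^ 2 • f y ∂μ := by
  have hzero := hharm _ (contDiff_quadBump_pow a r 2)
    (hasCompactSupport_quadBump_pow a r three_ne_zero) (tsupport_quadBump_pow_subset three_ne_zero)
  have hint : Integrable (fun y => (4 * r ^ 2) • quadBump a r y • f y) μ := by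
    simpa using (integrable_quadBump_pow_smul hf a r one_ne_zero).fun_smul (4 * r ^ 2)
  have hint_sq := (integrable_quadBump_pow_smul hf a r two_ne_zero).fun_smul (finrank ℝ G + 4 : ℝ)
  simp only [Nat.reduceAdd, laplacian_quadBump_cube, mul_smul (6 : ℝ), sub_smul] at hzero
  simp only [mul_smul _ (quadBump a r _), mul_smul _ (quadBump a r _ ^ 2)] at hzero
  rw [integral_smul, smul_eq_zero_iff_right (by norm_num), integral_sub hint hint_sq,
    integral_smul, integral_smul, sub_eq_zero] at hzero
  exact_mod_cast hzero

theorem IsWeaklyHarmonicOn.pow_smul_integral_quadBump_sq_smul_eq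
    (hharm : IsWeaklyHarmonicOn μ f (Metric.ball a R)) (hf : LocallyIntegrable f μ)
    (hr : r ∈ Ioo 0 R) (hs : s ∈ Ioo 0 R) :
    s ^ (finrank ℝ G + 4) • ∫ y, quadBump a r y ^ 2 • f y ∂μ =
      r ^ (finrank ℝ G + 4) • ∫ y, quadBump a s y ^ 2 • f y ∂μ := by
  refine pow_smul_eq_pow_smul_of_forall_hasDerivAt
    (fun t _ => hasDerivAt_integral_quadBump_sq_smul hf a t) (fun t ht => ?_) hr hs
  rw [smul_smul, show t * (4 * t) = 4 * t ^ 2 by ring]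
  refine (hharm.mono (Metric.closedBall_subset_ball ?_)).smul_integral_quadBump_smul_eq hf
  rw [abs_of_pos ht.1]
  exact ht.2

variable [μ.IsAddHaarMeasure]

theorem integral_quadBump_zero_sq (hr : 0 < r) :
    ∫ y : G, quadBump 0 r y ^ 2 ∂μ = r ^ (finrank ℝ G + 4) * ∫ y : G, quadBump 0 1 y ^ 2 ∂μ := by
  have hscale := Measure.integral_comp_smul μ (fun y : G => quadBump 0 r y ^ 2) r
  simp only [quadBump_zero_smul, mul_pow, integral_const_mul, smul_eq_mul] at hscale
  rw [abs_of_pos (by positivity), eq_inv_mul_iff_mul_eq₀ (by positivity)] at hscale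
  rw [← hscale]
  ring

theorem integral_quadBump_sq_pos (hr : r ≠ 0) : 0 < ∫ y, quadBump a r y ^ 2 ∂μ := by
  refine (continuous_quadBump.pow 2).integral_pos_of_hasCompactSupport_nonneg_nonzero
    (hasCompactSupport_quadBump_pow a r two_ne_zero) (fun y => sq_nonneg _) (x := a) ?_
  simp [quadBump, hr]

variable (μ) in
/-- The bump `(r² - ‖y‖²)₊²`, normalized to have integral `1`. The Laplacian of its analogue with
exponent `3` is governed by the `r`-derivative of the unnormalized bump, which makes convolution
with `quadKernel μ r` act trivially on weakly harmonic functions. -/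
noncomputable def quadKernel (r : ℝ) (y : G) : ℝ :=
  (∫ z : G, quadBump 0 r z ^ 2 ∂μ)⁻¹ * quadBump 0 r y ^ 2

theorem convolution_quadKernel_apply :
    (quadKernel μ r ⋆[ContinuousLinearMap.lsmul ℝ ℝ, μ] f) a =
      (∫ z : G, quadBump 0 r z ^ 2 ∂μ)⁻¹ • ∫ y, quadBump a r y ^ 2 • f y ∂μ := by
  simp only [convolution_lsmul_swap, quadKernel, quadBump_zero_sub, mul_smul, integral_smul]

theorem IsWeaklyHarmonicOn.convolution_quadKernel_eq_convolution_quadKernel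
    (hharm : IsWeaklyHarmonicOn μ f (Metric.ball a R)) (hf : LocallyIntegrable f μ)
    (hr : r ∈ Ioo 0 R) (hs : s ∈ Ioo 0 R) :
    (quadKernel μ r ⋆[ContinuousLinearMap.lsmul ℝ ℝ, μ] f) a =
      (quadKernel μ s ⋆[ContinuousLinearMap.lsmul ℝ ℝ, μ] f) a := by
  have hr0 : r ^ (finrank ℝ G + 4) ≠ 0 := pow_ne_zero _ hr.1.ne'
  have hs0 : s ^ (finrank ℝ G + 4) ≠ 0 := pow_ne_zero _ hs.1.ne'
  simp only [convolution_quadKernel_apply]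
  rw [integral_quadBump_zero_sq hr.1, integral_quadBump_zero_sq hs.1, mul_inv_rev, mul_inv_rev,
    mul_smul, mul_smul]
  congr 1
  rw [inv_smul_eq_iff₀ hr0, smul_comm, ← hharm.pow_smul_integral_quadBump_sq_smul_eq hf hr hs,
    inv_smul_smul₀ hs0]

theorem tendsto_convolution_quadKernel [CompleteSpace F] (hf : LocallyIntegrable f μ)
    (hcont : ContinuousAt f a) :
    Tendsto (fun r => (quadKernel μ r ⋆[ContinuousLinearMap.lsmul ℝ ℝ, μ] f) a) (𝓝[>] 0)
      (𝓝 (f a)) := by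
  refine convolution_tendsto_right ?_ ?_ ?_ (Eventually.of_forall fun _ => hf.aestronglyMeasurable)
    (hcont.tendsto.comp tendsto_snd) tendsto_const_nhds
  · filter_upwards [self_mem_nhdsWithin] with r hr y
    exact mul_nonneg (inv_nonneg.2 (integral_quadBump_sq_pos (ne_of_gt hr)).le) (sq_nonneg _)
  · filter_upwards [self_mem_nhdsWithin] with r hr
    simp only [quadKernel, integral_const_mul]
    exact inv_mul_cancel₀ (integral_quadBump_sq_pos (ne_of_gt hr)).ne'
  · refine Metric.nhds_basis_ball.smallSets.tendsto_right_iff.2 fun ε hε => ?_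
    filter_upwards [Ioo_mem_nhdsGT hε] with r hr y hy
    by_contra h
    refine hy ?_
    rw [quadKernel, quadBump_eq_zero, zero_pow two_ne_zero, mul_zero]
    rw [mem_ball_iff_norm, not_lt] at h
    exact (abs_of_pos hr.1).trans_le (hr.2.le.trans h)

theorem IsWeaklyHarmonicOn.convolution_quadKernel_eq [CompleteSpace F]
    (hharm : IsWeaklyHarmonicOn μ f (Metric.ball a R)) (hf : LocallyIntegrable f μ)
    (hcont : ContinuousAt f a) (hr : r ∈ Ioo 0 R) :
    (quadKernel μ r ⋆[ContinuousLinearMap.lsmul ℝ ℝ, μ] f) a = f a := by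
  refine tendsto_nhds_unique (tendsto_const_nhds.congr' ?_)
    (tendsto_convolution_quadKernel hf hcont)
  filter_upwards [Ioo_mem_nhdsGT (hr.1.trans hr.2)] with s hs
  exact hharm.convolution_quadKernel_eq_convolution_quadKernel hf hr hs

theorem contDiff_convolution_quadKernel (hf : LocallyIntegrable f μ) (r : ℝ) :
    ContDiff ℝ 1 (quadKernel μ r ⋆[ContinuousLinearMap.lsmul ℝ ℝ, μ] f) :=
  (hasCompactSupport_quadBump_pow 0 r two_ne_zero).mul_left.contDiff_convolution_left (n := 1) _
    (contDiff_const.mul (contDiff_quadBump_pow 0 r 1)) hf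

theorem IsWeaklyHarmonicOn.exists_contDiff_eq [CompleteSpace F] {Ω : Set G} (hΩ : IsOpen Ω)
    (hharm : IsWeaklyHarmonicOn μ f Ω) (hf : LocallyIntegrableOn f Ω μ) (ha : a ∈ Ω) :
    ∃ g : G → F, ContDiff ℝ 1 g ∧ ∀ᶠ b in 𝓝 a, ContinuousAt f b → g b = f b := by
  obtain ⟨R, hR, hRΩ⟩ := Metric.nhds_basis_closedBall.mem_iff.1 (hΩ.mem_nhds ha)
  set f₀ := (Metric.closedBall a R).indicator f
  have hf₀ : EqOn f f₀ (Metric.ball a R) := fun y hy =>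
    (indicator_of_mem (Metric.ball_subset_closedBall hy) f).symm
  have hf₀_int : LocallyIntegrable f₀ μ :=
    ((integrable_indicator_iff measurableSet_closedBall).2
      (hf.integrableOn_compact_subset hRΩ (isCompact_closedBall a R))).locallyIntegrable
  refine ⟨quadKernel μ (R / 3) ⋆[ContinuousLinearMap.lsmul ℝ ℝ, μ] f₀,
    contDiff_convolution_quadKernel hf₀_int _, ?_⟩
  filter_upwards [Metric.ball_mem_nhds a (half_pos hR)] with b hb hb_cont
  have hbR : Metric.ball b (R / 2) ⊆ Metric.ball a R :=
    Metric.ball_subset_ball' (by linarith [Metric.mem_ball.1 hb])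
  have hb_mem : Metric.ball a R ∈ 𝓝 b :=
    mem_of_superset (Metric.ball_mem_nhds b (half_pos hR)) hbR
  have hharm₀ : IsWeaklyHarmonicOn μ f₀ (Metric.ball b (R / 2)) :=
    (hharm.mono ((hbR.trans Metric.ball_subset_closedBall).trans hRΩ)).congr (hf₀.mono hbR)
  rw [hharm₀.convolution_quadKernel_eq hf₀_int (hb_cont.congr (hf₀.eventuallyEq_of_mem hb_mem))
    ⟨by positivity, by linarith⟩, ← hf₀ (mem_of_mem_nhds hb_mem)]

end Weyl

section Holomorphic

variable {V F : Type*} [NormedAddCommGroup V] [NormedSpace ℂ V] [NormedAddCommGroup F]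
  [NormedSpace ℂ F] {f : V → F} {f' : F} {U : Set V} {x v : V}

theorem lineDifferentiableAt_lineDeriv_of_differentiableOn [CompleteSpace F] (hU : IsOpen U)
    (hf : DifferentiableOn ℂ f U) (hx : x ∈ U) (v : V) :
    LineDifferentiableAt ℂ (fun y => lineDeriv ℂ f y v) x v := by
  have hline : DifferentiableOn ℂ (fun z : ℂ => f (x + z • v)) ((fun z : ℂ => x + z • v) ⁻¹' U) :=
    hf.comp (by fun_prop) (mapsTo_preimage _ _)
  have hpre : IsOpen ((fun z : ℂ => x + z • v) ⁻¹' U) := hU.preimage (by fun_prop)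
  have hderiv := (hline.deriv hpre).differentiableAt (hpre.mem_nhds (x := 0) (by simpa))
  rwa [deriv_comp_add_smul] at hderiv

variable [NormedSpace ℝ V] [IsScalarTower ℝ ℂ V] [NormedSpace ℝ F] [IsScalarTower ℝ ℂ F]

theorem hasLineDerivAt_real_of_complex (hf : HasLineDerivAt ℂ f f' x v) :
    HasLineDerivAt ℝ f f' x v := by
  have hline : HasDerivAt (fun z : ℂ => f (x + z • v)) f' (Complex.ofRealCLM 0) := by
    simpa only [map_zero, HasLineDerivAt] using hf
  simpa [HasLineDerivAt, Function.comp_def, ← Complex.coe_algebraMap] using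
    hline.scomp (0 : ℝ) Complex.ofRealCLM.hasDerivAt

theorem hasLineDerivAt_real_lineDeriv_of_differentiableOn [CompleteSpace F] (hU : IsOpen U)
    (hf : DifferentiableOn ℂ f U) (hx : x ∈ U) (v : V) :
    HasLineDerivAt ℝ (fun y => lineDeriv ℝ f y v)
      (lineDeriv ℂ (fun y => lineDeriv ℂ f y v) x v) x v := by
  have hderiv := lineDifferentiableAt_lineDeriv_of_differentiableOn hU hf hx v
  refine (hasLineDerivAt_real_of_complex hderiv.hasLineDerivAt).congr_of_eventuallyEq ?_
  filter_upwards [hU.mem_nhds hx] with y hy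
  exact (hasLineDerivAt_real_of_complex
    (hf.differentiableAt (hU.mem_nhds hy)).lineDifferentiableAt.hasLineDerivAt).lineDeriv

theorem lineDeriv_lineDeriv_add_lineDeriv_lineDeriv_I_smul [CompleteSpace F] (hU : IsOpen U)
    (hf : DifferentiableOn ℂ f U) (hx : x ∈ U) (v : V) :
    lineDeriv ℝ (fun y => lineDeriv ℝ f y v) x v +
      lineDeriv ℝ (fun y => lineDeriv ℝ f y (Complex.I • v)) x (Complex.I • v) = 0 := by
  have hI : lineDeriv ℂ (fun y => Complex.I • lineDeriv ℂ f y v) x v =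
      Complex.I • lineDeriv ℂ (fun y => lineDeriv ℂ f y v) x v :=
    deriv_fun_const_smul_field _ _
  rw [(hasLineDerivAt_real_lineDeriv_of_differentiableOn hU hf hx _).lineDeriv,
    (hasLineDerivAt_real_lineDeriv_of_differentiableOn hU hf hx _).lineDeriv]
  simp only [lineDeriv_smul]
  rw [hI, smul_smul, Complex.I_mul_I, neg_one_smul, add_neg_cancel]

theorem differentiableOn_complex_of_dense [CompleteSpace F] {g : V → F} (hg : ContDiff ℝ 1 g)
    {D : Set V} (hU : IsOpen U) (hD : Dense D) (h : ∀ x ∈ U ∩ D, DifferentiableAt ℂ g x) :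
    DifferentiableOn ℂ g U := by
  let restrict : (V →L[ℂ] F) → V →L[ℝ] F := ContinuousLinearMap.restrictScalars ℝ
  have hclosed : IsClosed (range restrict) :=
    (ContinuousLinearMap.restrictScalarsIsometry ℂ V F ℝ
      ℝ).isometry.isClosedEmbedding.isClosed_range
  have hsub : U ∩ D ⊆ fderiv ℝ g ⁻¹' range restrict := fun x hx =>
    ⟨fderiv ℂ g x, ((h x hx).hasFDerivAt.restrictScalars ℝ).fderiv.symm⟩
  intro x hx
  have hx' := closure_minimal hsub (hclosed.preimage (hg.continuous_fderiv one_ne_zero))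
    (hD.open_subset_closure_inter hU hx)
  exact ((differentiableAt_iff_restrictScalars ℝ
    (hg.differentiable one_ne_zero x)).2 hx').differentiableWithinAt

end Holomorphic

section Gluing

variable {𝕜 V F : Type*} [NontriviallyNormedField 𝕜] [NormedAddCommGroup V] [NormedSpace 𝕜 V]
  [NormedAddCommGroup F] [NormedSpace 𝕜 F]

theorem exists_differentiableOn_eqOn_of_locally {f : V → F} {Ω S : Set V} (hΩS : Ω ⊆ closure S)
    (hf : ContinuousOn f S)
    (hloc : ∀ a ∈ Ω, ∃ U ∈ 𝓝 a, ∃ g : V → F, DifferentiableOn 𝕜 g U ∧ EqOn g f (U ∩ S)) :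
    ∃ g : V → F, DifferentiableOn 𝕜 g Ω ∧ EqOn g f S := by
  refine ⟨extendFrom S f, fun a ha => ?_, fun a ha => extendFrom_eq (subset_closure ha) (hf a ha)⟩
  obtain ⟨U, hU, g, hg, hgf⟩ := hloc a ha
  have heq : ∀ b ∈ Ω, U ∈ 𝓝 b → extendFrom S f b = g b := fun b hb hUb => by
    have hgb : Tendsto g (𝓝[S] b) (𝓝 (g b)) :=
      (hg.differentiableAt hUb).continuousAt.mono_left nhdsWithin_le_nhds
    refine extendFrom_eq (hΩS hb) (hgb.congr' ?_)
    filter_upwards [self_mem_nhdsWithin, mem_nhdsWithin_of_mem_nhds hUb] with y hyS hyU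
    exact hgf ⟨hyU, hyS⟩
  have heq_near : extendFrom S f =ᶠ[𝓝[Ω] a] g := by
    filter_upwards [self_mem_nhdsWithin,
      mem_nhdsWithin_of_mem_nhds (eventually_mem_nhds_iff.2 hU)] with b hb hUb
    exact heq b hb hUb
  exact (hg.differentiableAt hU).differentiableWithinAt.congr_of_eventuallyEq heq_near
    (heq a ha hU)

end Gluing

section Removable

theorem isOpen_sdiff_of_isClosed_preimage_val {X : Type*} [TopologicalSpace X] {s t : Set X}
    (hs : IsOpen s) (ht : IsClosed ((fun x : s => (x : X)) ⁻¹' t)) : IsOpen (s \ t) := by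
  have himage := hs.isOpenMap_subtype_val _ ht.isOpen_compl
  rwa [← preimage_compl, Subtype.image_preimage_coe] at himage

variable {V F ι : Type*} [NormedAddCommGroup V] [InnerProductSpace ℝ V] [NormedSpace ℂ V]
  [IsScalarTower ℝ ℂ V] [FiniteDimensional ℝ V] [MeasurableSpace V] [BorelSpace V]
  {μ : Measure V} [μ.IsAddHaarMeasure] [NormedAddCommGroup F] [NormedSpace ℂ F] [NormedSpace ℝ F]
  [IsScalarTower ℝ ℂ F] [CompleteSpace F] [Fintype ι] {f : V → F} {Ω E : Set V}

theorem isWeaklyHarmonicOn_of_differentiableOn_sdiff (b : OrthonormalBasis (ι ⊕ ι) ℝ V)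
    (hb : ∀ i, b (.inr i) = Complex.I • b (.inl i)) (hU : IsOpen (Ω \ E))
    (hE : Measure.hausdorffMeasure (finrank ℝ V - 1 : ℝ) E = 0)
    (hf : DifferentiableOn ℂ f (Ω \ E)) (hint : LocallyIntegrableOn f Ω μ)
    (hint' : ∀ j, LocallyIntegrableOn
      (fun z => lineDeriv ℝ (fun w => lineDeriv ℝ f w (b j)) z (b j)) Ω μ) :
    IsWeaklyHarmonicOn μ f Ω := by
  refine isWeaklyHarmonicOn_of_hausdorffMeasure_eq_zero b hE (fun j x hx => ?_) (fun j x hx => ?_)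
    (fun x hx => ?_) hint hint'
  · exact (hasLineDerivAt_real_of_complex (hf.differentiableAt
      (hU.mem_nhds hx)).lineDifferentiableAt.hasLineDerivAt).lineDifferentiableAt
  · exact (hasLineDerivAt_real_lineDeriv_of_differentiableOn hU hf hx _).lineDifferentiableAt
  · rw [Fintype.sum_sum_type, ← Finset.sum_add_distrib]
    simp only [hb, lineDeriv_lineDeriv_add_lineDeriv_lineDeriv_I_smul hU hf hx,
      Finset.sum_const_zero]

theorem exists_differentiableOn_eqOn_of_isWeaklyHarmonicOn (hΩ : IsOpen Ω) (hU : IsOpen (Ω \ E))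
    (hE : Dense Eᶜ) (hf : DifferentiableOn ℂ f (Ω \ E)) (hharm : IsWeaklyHarmonicOn μ f Ω)
    (hint : LocallyIntegrableOn f Ω μ) :
    ∃ g : V → F, DifferentiableOn ℂ g Ω ∧ EqOn g f (Ω \ E) := by
  refine exists_differentiableOn_eqOn_of_locally (hE.open_subset_closure_inter hΩ)
    hf.continuousOn fun a ha => ?_
  obtain ⟨g, hg, hg_near⟩ := hharm.exists_contDiff_eq hΩ hint ha
  obtain ⟨W, hgf, hW_open, haW⟩ := eventually_nhds_iff.1 hg_near
  have hf_at : ∀ x ∈ Ω \ E, DifferentiableAt ℂ f x := fun x hx =>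
    hf.differentiableAt (hU.mem_nhds hx)
  have heq : EqOn g f (W ∩ (Ω \ E)) := fun x hx => hgf x hx.1 (hf_at x hx.2).continuousAt
  refine ⟨W ∩ Ω, (hW_open.inter hΩ).mem_nhds ⟨haW, ha⟩, g,
    differentiableOn_complex_of_dense hg (hW_open.inter hΩ) hE ?_,
    heq.mono (inter_subset_inter_left _ inter_subset_left)⟩
  rintro x ⟨⟨hxW, hxΩ⟩, hxE⟩
  exact (hf_at x ⟨hxΩ, hxE⟩).congr_of_eventuallyEq
    (heq.eventuallyEq_of_mem ((hW_open.inter hU).mem_nhds ⟨hxW, hxΩ, hxE⟩))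

theorem corollary6_general (b : OrthonormalBasis (ι ⊕ ι) ℝ V)
    (hb : ∀ i, b (.inr i) = Complex.I • b (.inl i)) (hΩ : IsOpen Ω)
    (hE_closed : IsClosed ((fun z : Ω => (z : V)) ⁻¹' E))
    (hE_null : Measure.hausdorffMeasure (finrank ℝ V - 1 : ℝ) E = 0)
    (hf : DifferentiableOn ℂ f (Ω \ E)) (hint : LocallyIntegrableOn f Ω (μ.restrict Eᶜ))
    (hint' : ∀ j, LocallyIntegrableOn
      (fun z => lineDeriv ℝ (fun w => lineDeriv ℝ f w (b j)) z (b j)) Ω (μ.restrict Eᶜ)) :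
    (∃ g : V → F, DifferentiableOn ℂ g Ω ∧ EqOn g f (Ω \ E)) ∧
      ∀ g₁ g₂ : V → F, DifferentiableOn ℂ g₁ Ω ∧ EqOn g₁ f (Ω \ E) →
        DifferentiableOn ℂ g₂ Ω ∧ EqOn g₂ f (Ω \ E) → EqOn g₁ g₂ Ω := by
  have hU : IsOpen (Ω \ E) := isOpen_sdiff_of_isClosed_preimage_val hΩ hE_closed
  have hE_ae : ∀ᵐ x ∂μ, x ∈ Eᶜ := measure_eq_zero_iff_ae_notMem.1
    (measure_eq_zero_of_hausdorffMeasure_eq_zero μ (by simp) hE_null)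
  have hE_dense : Dense Eᶜ := Measure.dense_of_ae hE_ae
  simp only [Measure.restrict_eq_self_of_ae_mem hE_ae] at hint hint'
  refine ⟨exists_differentiableOn_eqOn_of_isWeaklyHarmonicOn hΩ hU hE_dense hf
    (isWeaklyHarmonicOn_of_differentiableOn_sdiff b hb hU hE_null hf hint hint') hint,
    fun g₁ g₂ h₁ h₂ => ?_⟩
  exact (h₁.2.trans h₂.2.symm).of_subset_closure h₁.1.continuousOn h₂.1.continuousOn
    sdiff_subset (hE_dense.open_subset_closure_inter hΩ)

end Removable

section RealDirection

variable {n : ℕ}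

theorem realDirection_inr (k : Fin n) :
    realDirection n (.inr k) = Complex.I • realDirection n (.inl k) := by
  ext i
  simp [realDirection]

theorem orthonormal_realDirection (n : ℕ) : Orthonormal ℝ (realDirection n) := by
  have hinner (x : EuclideanSpace ℂ (Fin n)) (k : Fin n) (c : ℂ) :
      inner ℝ x (EuclideanSpace.single k c) = inner ℝ (x k) c := by
    rw [PiLp.inner_apply, Finset.sum_eq_single k] <;> simp +contextual
  rw [orthonormal_iff_ite]
  rintro (i | i) (j | j) <;>
    simp [realDirection, hinner, Complex.inner, apply_ite, eq_comm]

theorem finrank_real_euclideanSpace_complex (n : ℕ) :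
    finrank ℝ (EuclideanSpace ℂ (Fin n)) = 2 * n := by
  rw [← finrank_mul_finrank ℝ ℂ, Complex.finrank_real_complex, finrank_euclideanSpace_fin]

theorem exists_orthonormalBasis_coe_eq_realDirection (n : ℕ) :
    ∃ b : OrthonormalBasis (Fin n ⊕ Fin n) ℝ (EuclideanSpace ℂ (Fin n)), ⇑b = realDirection n := by
  have hon := orthonormal_realDirection n
  have hspan := hon.linearIndependent.span_eq_top_of_card_eq_finrank'
    (by simp [finrank_real_euclideanSpace_complex, two_mul])
  exact ⟨.mk hon hspan.ge, OrthonormalBasis.coe_mk hon hspan.ge⟩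

end RealDirection

theorem corollary6 (n : ℕ) (hn : 1 ≤ n)
    (Ω : Set (EuclideanSpace ℂ (Fin n))) (hΩ_open : IsOpen Ω) (hΩ_conn : IsConnected Ω)
    (E : Set (EuclideanSpace ℂ (Fin n))) (hEΩ : E ⊆ Ω)
    (hE_closed : IsClosed ((fun z : Ω => (z : EuclideanSpace ℂ (Fin n))) ⁻¹' E))
    (hE_null : Measure.hausdorffMeasure (2 * (n : ℝ) - 1) E = 0)
    (f : EuclideanSpace ℂ (Fin n) → ℂ)
    (hf_holo : DifferentiableOn ℂ f (Ω \ E))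
    (hf_int : MemL1Loc Ω E f)
    (hf_int2 : ∀ j : Fin n ⊕ Fin n, MemL1Loc Ω E (purePartial2 j f)) :
    (∃ g : EuclideanSpace ℂ (Fin n) → ℂ, IsHolomorphicExtension Ω E f g) ∧
      ∀ g₁ g₂ : EuclideanSpace ℂ (Fin n) → ℂ,
        IsHolomorphicExtension Ω E f g₁ → IsHolomorphicExtension Ω E f g₂ → EqOn g₁ g₂ Ω := by
  obtain ⟨b, hb⟩ := exists_orthonormalBasis_coe_eq_realDirection n
  exact corollary6_general b (by simpa only [hb] using realDirection_inr) hΩ_open hE_closed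
    (by simpa [finrank_real_euclideanSpace_complex] using hE_null) hf_holo hf_int
    (by rw [hb]; exact hf_int2)
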